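/- Let $\mathbb F$ be a field of characteristic zero. Let $O$ be the Onsager Lie algebra over $\mathbb F$, that is, the Lie algebra with generators $A,B$ and relations $[A,[A,[A,B]]]=4[A,B]$, $[B,[B,[B,A]]]=4[B,A]$. Let $e,f,h$ be the standard basis of $\mathfrak{sl}_2$ over $\mathbb F$ ($[h,e]=2e$, $[h,f]=-2f$, $[e,f]=h$) and put $x=2e-h$, $y=-2f-h$, $z=h$. Let $\mathcal A=\mathbb F[t,t^{-1},(t-1)^{-1}]$, and let $L(\mathfrak{sl}_2)^+=\mathfrak{sl}_2\otimes\mathcal A$ be the Lie algebra with bracket $[u\otimes a,v\otimes b]=[u,v]\otimes ab$, on which $\mathcal A$ acts by $(u\otimes a)b=u\otimes ab$. For $i\in\mathbb N=\{0,1,2,\dots\}$ define elements of $L(\mathfrak{sl}_2)^+$ by $$A_i^{\uparrow\uparrow}=x\otimes(t-1)^i,\qquad B_i^{\uparrow\uparrow}=(y\otimes t+z\otimes(t-1))(t-1)^i,\qquad \psi_i^{\uparrow\uparrow}=z\otimes(t-1)^i.$$ The Lie algebra homomorphism $O\to L(\mathfrak{sl}_2)^+$ that sends $A\mapsto x\otimes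 1$ and $B\mapsto y\otimes t+z\otimes(t-1)$ is well defined and injective. Identify $O$ with its image under this homomorphism. Then $O$ has a basis $$A_i^{\uparrow\uparrow},\qquad B_i^{\uparrow\uparrow},\qquad \psi_{i+1}^{\uparrow\uparrow}\qquad(i\in\mathbb N),$$ where $A_0^{\uparrow\uparrow}=A$ and $B_0^{\uparrow\uparrow}=B$. Moreover, for all $i,j\in\mathbb N$ (in $L(\mathfrak{sl}_2)^+$), \begin{align*} [A_i^{\uparrow\uparrow},A_j^{\uparrow\uparrow}]&=0,\qquad [B_i^{\uparrow\uparrow},B_j^{\uparrow\uparrow}]=0,\qquad [\psi_i^{\uparrow\uparrow},\psi_j^{\uparrow\uparrow}]=0,\\ [\psi_i^{\uparrow\uparrow},A_j^{\uparrow\uparrow}]&=2\psi_{i+j}^{\uparrow\uparrow}+2A_{i+j}^{\uparrow\uparrow},\\ [B_i^{\uparrow\uparrow},\psi_j^{\uparrow\uparrow}]&=2B_{i+j}^{\uparrow\uparrow}+2\psi_{i+j}^{\uparrow\uparrow},\\ [A_i^{\uparrow\uparrow},B_j^{\uparrow\uparrow}]&=2A_{i+j}^{\uparrow\uparrow}+2B_{i+j}^{\uparrow\uparrow}-4\psi_{i+j+1}^{\uparrow\uparrow}.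 \end{align*} -/

import Mathlib

open scoped TensorProduct Polynomial

noncomputable section

/-! ### The Onsager Lie algebra, by generators and relations -/

/-- The two generating symbols of the Onsager Lie algebra. -/
inductive OnsagerGen : Type
  | A
  | B

/-- The Dolan-Grady relators `[A,[A,[A,B]]] - 4[A,B]` and `[B,[B,[B,A]]] - 4[B,A]` in the free
Lie algebra on `A`, `B`. -/
def dolanGradyRelators (F : Type*) [Field F] : Set (FreeLieAlgebra F OnsagerGen) :=
  let a : FreeLieAlgebra F OnsagerGen := FreeLieAlgebra.of F OnsagerGen.A
  let b : FreeLieAlgebra F OnsagerGen := FreeLieAlgebra.of F OnsagerGen.B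
  {⁅a, ⁅a, ⁅a, b⁆⁆⁆ - (4 : F) • ⁅a, b⁆, ⁅b, ⁅b, ⁅b, a⁆⁆⁆ - (4 : F) • ⁅b, a⁆}

/-- The Lie ideal generated by the Dolan-Grady relators. -/
def dolanGradyIdeal (F : Type*) [Field F] : LieIdeal F (FreeLieAlgebra F OnsagerGen) :=
  LieSubmodule.lieSpan F (FreeLieAlgebra F OnsagerGen) (dolanGradyRelators F)

/-- The Onsager Lie algebra `O` over `F`: generators `A`, `B`, Dolan-Grady relations. -/
abbrev Onsager (F : Type*) [Field F] : Type _ :=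
  FreeLieAlgebra F OnsagerGen ⧸ dolanGradyIdeal F

/-- The standard generator `A` of `O`. -/
def Onsager.A (F : Type*) [Field F] : Onsager F :=
  LieSubmodule.Quotient.mk (FreeLieAlgebra.of F OnsagerGen.A)

/-- The standard generator `B` of `O`. -/
def Onsager.B (F : Type*) [Field F] : Onsager F :=
  LieSubmodule.Quotient.mk (FreeLieAlgebra.of F OnsagerGen.B)

/-! ### The equitable basis of `sl₂` -/

/-- The Lie algebra `sl₂` of trace-zero two-by-two matrices. -/
abbrev SlTwo (F : Type*) [Field F] : Type _ := LieAlgebra.SpecialLinear.sl (Fin 2) F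

/-- The element `e` of `sl₂`. -/
def SlTwo.e (F : Type*) [Field F] : SlTwo F :=
  ⟨!![0, 1; 0, 0], by simp [LieAlgebra.SpecialLinear.sl, Matrix.trace, Fin.sum_univ_two]⟩

/-- The element `f` of `sl₂`. -/
def SlTwo.f (F : Type*) [Field F] : SlTwo F :=
  ⟨!![0, 0; 1, 0], by simp [LieAlgebra.SpecialLinear.sl, Matrix.trace, Fin.sum_univ_two]⟩

/-- The element `h` of `sl₂`. -/
def SlTwo.h (F : Type*) [Field F] : SlTwo F :=
  ⟨!![1, 0; 0, -1], by simp [LieAlgebra.SpecialLinear.sl, Matrix.trace, Fin.sum_univ_two]⟩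

/-- `x = 2e - h`. -/
def SlTwo.x (F : Type*) [Field F] : SlTwo F := (2 : F) • SlTwo.e F - SlTwo.h F

/-- `y = -2f - h`. -/
def SlTwo.y (F : Type*) [Field F] : SlTwo F := -((2 : F) • SlTwo.f F) - SlTwo.h F

/-- `z = h`. -/
def SlTwo.z (F : Type*) [Field F] : SlTwo F := SlTwo.h F

/-! ### The three-point `sl₂` loop algebra -/

/-- The algebra `𝒜 = F[t, t⁻¹, (t-1)⁻¹]`, the localization of `F[t]` at `t (t-1)`. -/
abbrev ThreePointRing (F : Type*) [Field F] : Type _ :=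
  Localization.Away (Polynomial.X * (Polynomial.X - 1) : F[X])

/-- The indeterminate `t`, as an element of `𝒜`. -/
def ThreePointRing.t (F : Type*) [Field F] : ThreePointRing F :=
  algebraMap F[X] (ThreePointRing F) Polynomial.X

/-- The three-point `sl₂` loop algebra `L(sl₂)⁺`, with `[u ⊗ a, v ⊗ b] = [u,v] ⊗ ab`. Mathlib
writes the scalar factor on the left: the vector `u ⊗ a` is `a ⊗ₜ u`, and the action of `b : 𝒜`
that sends `u ⊗ a` to `u ⊗ ab` is `b • _`. -/
abbrev ThreePointLoop (F : Type*) [Field F] : Type _ := ThreePointRing F ⊗[F] SlTwo F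

/-- `A↑↑ᵢ = x ⊗ (t-1)^i`. -/
def Aup (F : Type*) [Field F] (i : ℕ) : ThreePointLoop F :=
  ((ThreePointRing.t F - 1) ^ i) ⊗ₜ[F] SlTwo.x F

/-- `B↑↑ᵢ = (y ⊗ t + z ⊗ (t-1)) (t-1)^i`. -/
def Bup (F : Type*) [Field F] (i : ℕ) : ThreePointLoop F :=
  (ThreePointRing.t F - 1) ^ i •
    (ThreePointRing.t F ⊗ₜ[F] SlTwo.y F + (ThreePointRing.t F - 1) ⊗ₜ[F] SlTwo.z F)

/-- `ψ↑↑ᵢ = z ⊗ (t-1)^i`. -/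
def psiUp (F : Type*) [Field F] (i : ℕ) : ThreePointLoop F :=
  ((ThreePointRing.t F - 1) ^ i) ⊗ₜ[F] SlTwo.z F

/-! ### The homomorphism `O → L(sl₂)⁺` through which `O` is viewed inside `L(sl₂)⁺` -/

/-- The images in `L(sl₂)⁺` of the generators: `A ↦ x ⊗ 1` and `B ↦ y ⊗ t + z ⊗ (t-1)`. -/
def onsagerGenToLoop (F : Type*) [Field F] : OnsagerGen → ThreePointLoop F
  | OnsagerGen.A => 1 ⊗ₜ[F] SlTwo.x F
  | OnsagerGen.B =>
      ThreePointRing.t F ⊗ₜ[F] SlTwo.y F + (ThreePointRing.t F - 1) ⊗ₜ[F] SlTwo.z F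

theorem SlTwo.lie_x_y (F : Type*) [Field F] :
    ⁅SlTwo.x F, SlTwo.y F⁆ = (2 : F) • SlTwo.x F + (2 : F) • SlTwo.y F := by
  apply Subtype.ext
  ext i j
  fin_cases i <;> fin_cases j <;>
    simp [SlTwo.x, SlTwo.y, SlTwo.e, SlTwo.f, SlTwo.h, Ring.lie_def] <;>
    ring_nf <;> simp

theorem SlTwo.lie_y_z (F : Type*) [Field F] :
    ⁅SlTwo.y F, SlTwo.z F⁆ = (2 : F) • SlTwo.y F + (2 : F) • SlTwo.z F := by
  apply Subtype.ext
  ext i j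
  fin_cases i <;> fin_cases j <;>
    simp [SlTwo.y, SlTwo.z, SlTwo.f, SlTwo.h, Ring.lie_def] <;>
    ring_nf <;> simp

theorem SlTwo.lie_z_x (F : Type*) [Field F] :
    ⁅SlTwo.z F, SlTwo.x F⁆ = (2 : F) • SlTwo.z F + (2 : F) • SlTwo.x F := by
  apply Subtype.ext
  ext i j
  fin_cases i <;> fin_cases j <;>
    simp [SlTwo.x, SlTwo.z, SlTwo.e, SlTwo.h, Ring.lie_def] <;>
    ring_nf <;> simp

/-- Equitable elements `x`, `y`, `z` give a Dolan-Grady pair `x`, `t y + (t-1) z`. -/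
theorem dolanGrady_of_equitable {R L : Type*} [CommRing R] [LieRing L] [LieAlgebra R L]
    (t : R) (x y z : L) (hxy : ⁅x, y⁆ = (2 : R) • x + (2 : R) • y)
    (hyz : ⁅y, z⁆ = (2 : R) • y + (2 : R) • z) (hzx : ⁅z, x⁆ = (2 : R) • z + (2 : R) • x) :
    ⁅x, ⁅x, ⁅x, t • y + (t - 1) • z⁆⁆⁆ = (4 : R) • ⁅x, t • y + (t - 1) • z⁆ ∧
    ⁅t • y + (t - 1) • z, ⁅t • y + (t - 1) • z, ⁅t • y + (t - 1) • z, x⁆⁆⁆ =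
      (4 : R) • ⁅t • y + (t - 1) • z, x⁆ := by
  have hyx : ⁅y, x⁆ = -((2 : R) • x + (2 : R) • y) := by rw [← hxy, lie_skew]
  have hzy : ⁅z, y⁆ = -((2 : R) • y + (2 : R) • z) := by rw [← hyz, lie_skew]
  have hxz : ⁅x, z⁆ = -((2 : R) • z + (2 : R) • x) := by rw [← hzx, lie_skew]
  constructor <;>
  · simp only [lie_add, add_lie, lie_smul, smul_lie, lie_self, hxy, hyz, hzx, hyx, hzy, hxz,
      lie_neg, smul_zero, add_zero, zero_add]
    module

theorem dolanGradyIdeal_le_ker (F : Type*) [Field F] :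
    dolanGradyIdeal F ≤ (FreeLieAlgebra.lift F (onsagerGenToLoop F)).ker := by
  have e : ∀ (r : ThreePointRing F) (u : SlTwo F), r ⊗ₜ[F] u =
      r • ((1 : ThreePointRing F) ⊗ₜ[F] u) :=
    fun r u => by simp [TensorProduct.smul_tmul']
  have two : ∀ v : ThreePointLoop F, (2 : F) • v = (2 : ThreePointRing F) • v := fun v => by
    simp only [ofNat_smul_eq_nsmul]
  have four : ∀ v : ThreePointLoop F, (4 : F) • v = (4 : ThreePointRing F) • v := fun v => by
    simp only [ofNat_smul_eq_nsmul]
  have key : ∀ u v w w' : SlTwo F, ⁅u, v⁆ = (2 : F) • w + (2 : F) • w' →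
      ⁅(1 : ThreePointRing F) ⊗ₜ[F] u, (1 : ThreePointRing F) ⊗ₜ[F] v⁆ =
        (2 : ThreePointRing F) • ((1 : ThreePointRing F) ⊗ₜ[F] w) +
        (2 : ThreePointRing F) • ((1 : ThreePointRing F) ⊗ₜ[F] w') := by
    intro u v w w' h
    rw [LieAlgebra.ExtendScalars.bracket_tmul, h, TensorProduct.tmul_add, TensorProduct.tmul_smul,
      TensorProduct.tmul_smul, two, two, mul_one]
  obtain ⟨h1, h2⟩ := dolanGrady_of_equitable (ThreePointRing.t F)
    ((1 : ThreePointRing F) ⊗ₜ[F] SlTwo.x F) ((1 : ThreePointRing F) ⊗ₜ[F] SlTwo.y F)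
    ((1 : ThreePointRing F) ⊗ₜ[F] SlTwo.z F) (key _ _ _ _ (SlTwo.lie_x_y F))
    (key _ _ _ _ (SlTwo.lie_y_z F)) (key _ _ _ _ (SlTwo.lie_z_x F))
  refine LieSubmodule.lieSpan_le.2 ?_
  rintro v (rfl | rfl)
  · simp only [SetLike.mem_coe, LieHom.mem_ker, map_sub, map_smul, LieHom.map_lie,
      FreeLieAlgebra.lift_of_apply, onsagerGenToLoop]
    rw [four, e (ThreePointRing.t F), e (ThreePointRing.t F - 1), h1, sub_self]
  · simp only [SetLike.mem_coe, LieHom.mem_ker, map_sub, map_smul, LieHom.map_lie,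
      FreeLieAlgebra.lift_of_apply, onsagerGenToLoop]
    rw [four, e (ThreePointRing.t F), e (ThreePointRing.t F - 1), h2, sub_self]

/-- The Lie algebra homomorphism `O → L(sl₂)⁺` that sends the standard generators `A`, `B` to
`x ⊗ 1` and `y ⊗ t + z ⊗ (t-1)`. -/
def onsagerToLoop (F : Type*) [Field F] : Onsager F →ₗ⁅F⁆ ThreePointLoop F :=
  { (dolanGradyIdeal F).toSubmodule.liftQ
      (FreeLieAlgebra.lift F (onsagerGenToLoop F) :
        FreeLieAlgebra F OnsagerGen →ₗ[F] ThreePointLoop F)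
      (fun v hv => LieHom.mem_ker.1 (dolanGradyIdeal_le_ker F hv)) with
    map_lie' := by
      rintro ⟨u⟩ ⟨v⟩
      exact LieHom.map_lie (FreeLieAlgebra.lift F (onsagerGenToLoop F)) u v }

end

/-! A spanning family of `O` is exhibited whose image in `L(sl₂)⁺` is linearly independent; this
gives the basis and the injectivity at once.

Spanning: put `c 0 = A`, `c 1 = B` and extend to all of `ℤ` by `[[B, A], c k] = 2 (c (k + 1) - c (k
- 1))`. The Dolan-Grady relations alone imply Onsager's relations `[c k, c l] = [c (k - l), c 0]`
and `[[c m, c 0], c l] = 2 (c (l + m) - c (l - m))` (`dolanGrady_reflect`,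
`onsager_relations_step`). Hence the `c k` and `[c k, c 0]` span a subspace stable under `ad A` and
`ad B`, which is all of `O`.

Change of basis: in the loop algebra `c (k + 1) + 2 c k + c (k - 1) = -4 (t - 1) c k`
(`three_term_recurrence`). So multiplication by `t - 1` lifts to the difference operator `seqShift`
on sequences in `O`. Its iterates at `0` and `1` lift `A↑↑`, `B↑↑` and, through `[c k, c 0]`, `ψ↑↑`,
and still span. Independence is read off from matrix entries, since `t - 1` is transcendental. -/

/-! ### Reflection of Dolan-Grady pairs -/

/-- Reflecting `b` in `h` sends a Dolan-Grady pair to a Dolan-Grady pair. -/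
theorem dolanGrady_reflect {F L : Type*} [Field F] [CharZero F] [LieRing L] [LieAlgebra F L]
    {h b u : L} (hu : ⁅h, b⁆ = u) (h1 : ⁅h, ⁅h, u⁆⁆ = (4 : F) • u)
    (h2 : ⁅b, ⁅b, u⁆⁆ = (4 : F) • u) :
    ⁅h, b - (2⁻¹ : F) • ⁅h, u⁆⁆ = -u ∧
    ⁅b - (2⁻¹ : F) • ⁅h, u⁆, ⁅b - (2⁻¹ : F) • ⁅h, u⁆, u⁆⁆ = (4 : F) • u := by
  set v := ⁅h, u⁆ with hv
  -- `x` is the part of `b` that commutes with `h`; the reflection fixes `x` and negates `v`.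
  obtain ⟨x, hx⟩ : ∃ x, x = b - (4⁻¹ : F) • v := ⟨_, rfl⟩
  have hb : b = x + (4⁻¹ : F) • v := by rw [hx]; abel
  have hhx : ⁅h, x⁆ = 0 := by
    rw [hx, lie_sub, lie_smul, hu, h1, smul_smul]; norm_num
  have hb' : b - (2⁻¹ : F) • v = x - (4⁻¹ : F) • v := by
    rw [hb]; module
  refine ⟨?_, ?_⟩
  · rw [lie_sub, lie_smul, hu, h1]; module
  rw [hb']
  rw [hb] at h2
  -- `[b, [b, u]] - 4u = O + E/4`, with `O` even and `E` odd in the occurrences of `v` coming from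
  -- `b`. The reflected expression is `O - E/4`, so it suffices that `E = 0`.
  obtain ⟨E, hE⟩ : ∃ E, E = ⁅x, ⁅v, u⁆⁆ + ⁅v, ⁅x, u⁆⁆ := ⟨_, rfl⟩
  obtain ⟨O, hO⟩ : ∃ O, O = ⁅x, ⁅x, u⁆⁆ + (16⁻¹ : F) • ⁅v, ⁅v, u⁆⁆ - (4 : F) • u := ⟨_, rfl⟩
  have hEO : E = -(4 : F) • O := by
    have : O + (4⁻¹ : F) • E = 0 := by
      rw [hE, hO, ← sub_eq_zero.2 h2]
      simp only [add_lie, lie_add, smul_lie, lie_smul]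
      module
    rw [← neg_eq_of_add_eq_zero_left this]; module
  have hvu : ⁅h, ⁅v, u⁆⁆ = 0 := by
    rw [leibniz_lie, h1, ← hv]; simp
  have hxu : ⁅h, ⁅x, u⁆⁆ = ⁅x, v⁆ := by
    rw [leibniz_lie, hhx, ← hv]; simp
  have hxv : ⁅h, ⁅x, v⁆⁆ = (4 : F) • ⁅x, u⁆ := by
    rw [leibniz_lie, hhx, h1]; simp
  have hO1 : ⁅h, O⁆ = ⁅x, ⁅x, v⁆⁆ + (4⁻¹ : F) • ⁅u, ⁅v, u⁆⁆ - (4 : F) • v := by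
    rw [hO]
    simp only [lie_add, lie_sub, lie_smul]
    rw [leibniz_lie h x, leibniz_lie h v, hvu, hhx, hxu, h1, ← hv]
    simp only [smul_lie, zero_lie, lie_zero]
    module
  -- `u` and `v` lie in the weights `±2` of `ad h`, while `x` and `[v, u]` have weight `0`: so `O`
  -- has weights `±2`, whereas `E` has only `0` and `±4`. As `E = -4 O`, both vanish.
  have hO2 : ⁅h, ⁅h, O⁆⁆ = (4 : F) • O := by
    rw [hO1, hO]
    simp only [lie_add, lie_sub, lie_smul]
    rw [leibniz_lie h x, leibniz_lie h u, hvu, hhx, hxv, h1, ← hv]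
    simp only [zero_lie, lie_zero, lie_smul]
    module
  have hE1 : ⁅h, E⁆ = (4 : F) • ⁅u, ⁅x, u⁆⁆ + ⁅v, ⁅x, v⁆⁆ := by
    rw [hE, lie_add, leibniz_lie h x ⁅v, u⁆, leibniz_lie h v ⁅x, u⁆, hvu, hhx, hxu, h1]
    simp
  have hE2 : ⁅h, ⁅h, E⁆⁆ = (8 : F) • (⁅v, ⁅x, u⁆⁆ + ⁅u, ⁅x, v⁆⁆) := by
    rw [hE1, lie_add, lie_smul, leibniz_lie h u, leibniz_lie h v, hxu, hxv, h1, ← hv]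
    simp only [smul_lie, lie_smul]
    module
  have hE3 : ⁅h, ⁅h, ⁅h, E⁆⁆⁆ = (16 : F) • ⁅h, E⁆ := by
    rw [hE2, hE1, lie_smul, lie_add, leibniz_lie h u, leibniz_lie h v, hxu, hxv, h1, ← hv]
    simp only [smul_lie, lie_smul]
    module
  have hE2' : ⁅h, ⁅h, E⁆⁆ = (4 : F) • E := by
    rw [hEO, lie_smul, lie_smul, hO2, smul_comm]
  have hE1' : ⁅h, E⁆ = 0 := by
    rw [hE2', lie_smul] at hE3
    have : (12 : F) • ⁅h, E⁆ = 0 := by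
      rw [← sub_eq_zero] at hE3
      rw [← neg_eq_zero, ← hE3]
      module
    exact (smul_eq_zero.1 this).resolve_left (by norm_num)
  have hE0 : E = 0 := by
    rw [hE1', lie_zero] at hE2'
    exact (smul_eq_zero.1 hE2'.symm).resolve_left (by norm_num)
  rw [← sub_eq_zero]
  calc _ = (⁅x + (4⁻¹ : F) • v, ⁅x + (4⁻¹ : F) • v, u⁆⁆ - (4 : F) • u) - (2⁻¹ : F) • E := by
        rw [hE]
        simp only [add_lie, lie_add, sub_lie, lie_sub, smul_lie, lie_smul]
        module
    _ = 0 := by rw [h2, hE0]; simp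

/-! ### The two-sided sequence attached to a Dolan-Grady pair -/

/-- The step `(p, q) ↦ (q, p + (1/2) [g, q])` that generates the two-sided Onsager sequence. -/
def onsagerStep (F : Type*) {L : Type*} [Field F] [LieRing L] [LieAlgebra F L] (g : L) :
    Equiv.Perm (L × L) where
  toFun p := (p.2, p.1 + (2⁻¹ : F) • ⁅g, p.2⁆)
  invFun p := (p.2 - (2⁻¹ : F) • ⁅g, p.1⁆, p.1)
  left_inv p := by simp
  right_inv p := by simp

/-- The two-sided sequence `c` with `c 0 = a`, `c 1 = b` and
`[[b, a], c k] = 2 (c (k + 1) - c (k - 1))`. -/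
def onsagerSeq (F : Type*) {L : Type*} [Field F] [LieRing L] [LieAlgebra F L] (a b : L) (k : ℤ) :
    L :=
  ((onsagerStep F ⁅b, a⁆ ^ k) (a, b)).1

section OnsagerRelations

variable {F L : Type*} [Field F] [LieRing L] [LieAlgebra F L]

@[simp] theorem onsagerSeq_zero (a b : L) : onsagerSeq F a b 0 = a := rfl

theorem onsagerStep_zpow (a b : L) (k : ℤ) :
    (onsagerStep F ⁅b, a⁆ ^ k) (a, b) = (onsagerSeq F a b k, onsagerSeq F a b (k + 1)) := by
  refine Prod.ext rfl ?_
  change _ = ((onsagerStep F ⁅b, a⁆ ^ (k + 1)) (a, b)).1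
  rw [add_comm, zpow_one_add]
  rfl

@[simp] theorem onsagerSeq_one (a b : L) : onsagerSeq F a b 1 = b :=
  (congrArg Prod.snd (onsagerStep_zpow (F := F) a b 0)).symm

theorem onsagerSeq_add_two (a b : L) (k : ℤ) :
    onsagerSeq F a b (k + 2) =
      onsagerSeq F a b k + (2⁻¹ : F) • ⁅⁅b, a⁆, onsagerSeq F a b (k + 1)⁆ := by
  have h := congrArg Prod.snd (onsagerStep_zpow (F := F) a b (k + 1))
  rw [add_comm k 1, zpow_one_add, Equiv.Perm.mul_apply, onsagerStep_zpow, add_comm 1 k,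
    add_assoc] at h
  exact h.symm

variable [CharZero F]

theorem lie_onsagerSeq (a b : L) (k : ℤ) :
    ⁅⁅b, a⁆, onsagerSeq F a b k⁆ =
      (2 : F) • (onsagerSeq F a b (k + 1) - onsagerSeq F a b (k - 1)) := by
  have h := onsagerSeq_add_two (F := F) a b (k - 1)
  rw [sub_add_cancel, show k - 1 + 2 = k + 1 by ring] at h
  rw [h]
  module

/-- The reflection of `c k` in `c (k + 1)` is `c (k + 2)`, so `dolanGrady_reflect` carries one
consecutive pair to the next. The last two conjuncts are the Dolan-Grady relations that keep the
induction going. -/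
theorem lie_onsagerSeq_succ_aux {a b : L} (ha : ⁅a, ⁅a, ⁅a, b⁆⁆⁆ = (4 : F) • ⁅a, b⁆)
    (hb : ⁅b, ⁅b, ⁅b, a⁆⁆⁆ = (4 : F) • ⁅b, a⁆) (k : ℤ) :
    ⁅onsagerSeq F a b (k + 1), onsagerSeq F a b k⁆ = ⁅b, a⁆ ∧
    ⁅onsagerSeq F a b k, ⁅onsagerSeq F a b k, ⁅b, a⁆⁆⁆ = (4 : F) • ⁅b, a⁆ ∧
    ⁅onsagerSeq F a b (k + 1), ⁅onsagerSeq F a b (k + 1), ⁅b, a⁆⁆⁆ = (4 : F) • ⁅b, a⁆ := by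
  induction k using Int.induction_on with
  | zero =>
    refine ⟨by simp, ?_, by simpa using hb⟩
    rw [← lie_skew a b, lie_neg, lie_neg, smul_neg, neg_inj] at ha
    exact ha
  | succ k ih =>
    obtain ⟨h1, h2, h3⟩ := ih
    have h := dolanGrady_reflect h1 h3 h2
    have e : onsagerSeq F a b ((k : ℤ) + 1 + 1) = onsagerSeq F a b k -
        (2⁻¹ : F) • ⁅onsagerSeq F a b (k + 1), ⁅b, a⁆⁆ := by
      rw [add_assoc, one_add_one_eq_two, onsagerSeq_add_two, ← lie_skew]; module
    rw [← e] at h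
    exact ⟨by rw [← lie_skew, h.1, neg_neg], h3, h.2⟩
  | pred k ih =>
    obtain ⟨h1, h2, h3⟩ := ih
    have h1' : ⁅onsagerSeq F a b (-k), onsagerSeq F a b (-k + 1)⁆ = -⁅b, a⁆ := by
      rw [← lie_skew, h1]
    -- Downwards, `c (-k + 1)` is reflected in `c (-k)`, and the common bracket changes sign.
    have h := dolanGrady_reflect (F := F) h1' (by rw [lie_neg, lie_neg, smul_neg, h2])
      (by rw [lie_neg, lie_neg, smul_neg, h3])
    have e : onsagerSeq F a b (-(k : ℤ) - 1) = onsagerSeq F a b (-k + 1) -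
        (2⁻¹ : F) • ⁅onsagerSeq F a b (-k), -⁅b, a⁆⁆ := by
      have := lie_onsagerSeq (F := F) a b (-k)
      rw [lie_neg, lie_skew, this]; module
    rw [← e] at h
    rw [sub_add_cancel]
    refine ⟨by rw [h.1, neg_neg], ?_, h2⟩
    have h' := h.2
    rwa [lie_neg, lie_neg, smul_neg, neg_inj] at h'

/-! ### Onsager's relations -/

theorem sub_eq_nsmul_of_sub_const {M : Type*} [AddCommGroup M] {f : ℤ → M} {w : M}
    (h : ∀ l, f l - f (l - 1) = w) (n : ℕ) : f 0 - f (-n) = n • w := by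
  induction n with
  | zero => simp
  | succ n ih =>
    have := h (-n)
    rw [succ_nsmul, ← ih, ← this, Nat.cast_succ, neg_add']
    abel

theorem apply_eq_of_sub_pred_eq_zero {M : Type*} [AddCommGroup M] {f : ℤ → M}
    (h : ∀ l, f l - f (l - 1) = 0) (l : ℤ) : f l = f 0 := by
  induction l using Int.induction_on with
  | zero => rfl
  | succ k ih => rw [← ih, sub_eq_zero.1 (h (k + 1)), add_sub_cancel_right]
  | pred k ih => rw [← ih, ← sub_eq_zero.1 (h (-k))]

/-- The inductive step for the Onsager relations. -/
theorem onsager_relations_step {c : ℤ → L} {g : L} {n : ℕ} {p q : L}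
    (hrec : ∀ k, ⁅g, c k⁆ = (2 : F) • (c (k + 1) - c (k - 1)))
    (hg : ∀ k, ⁅c (k + 1), c k⁆ = g)
    (hp : ∀ l : ℤ, ⁅c (l + n), c l⁆ = p)
    (hq : ∀ l : ℤ, ⁅c (l + (n + 1)), c l⁆ = q)
    (hq' : ∀ l : ℤ, ⁅q, c l⁆ = (2 : F) • (c (l + (n + 1)) - c (l - (n + 1)))) :
    ⁅g, q⁆ = 0 ∧ ∀ l : ℤ, ⁅c (l + (n + 2)), c l⁆ = ⁅c (n + 2), c 0⁆ := by
  obtain ⟨f, hf⟩ : ∃ f : ℤ → L, ∀ l, f l = ⁅c (l + (n + 2)), c l⁆ := ⟨_, fun _ => rfl⟩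
  -- Apply `ad g` to `q = [c (l + n + 1), c l]`: the two brackets of index difference `n` both equal
  -- `p` and cancel. Thus `f` is an arithmetic progression.
  have h1 (l : ℤ) : ⁅g, q⁆ = (2 : F) • (f l - f (l - 1)) := by
    have e1 : ⁅c (l + n), c l⁆ = p := hp l
    have e2 : ⁅c (l + (n + 1)), c (l + 1)⁆ = p := by
      rw [← hp (l + 1)]; congr 2; ring
    rw [hf, hf, ← hq l, leibniz_lie, hrec, hrec, lie_smul, smul_lie, sub_lie, lie_sub, e2,
      show l + (n + 1 : ℤ) + 1 = l + (n + 2) by ring, show l + (n + 1 : ℤ) - 1 = l + n by ring, e1,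
      show l - 1 + (n + 2 : ℤ) = l + (n + 1) by ring]
    module
  have h1' (l : ℤ) : f l - f (l - 1) = (2⁻¹ : F) • ⁅g, q⁆ := by
    rw [h1 l]; module
  -- The same bracket expanded through `g = [c 1, c 0]` spans `n + 1` increments of `f`, so `[q, g]
  -- = (n + 1) [g, q]` and `(n + 2) [g, q] = 0`.
  have h2 : ⁅q, g⁆ = (2 : F) • (f 0 - f (-(n + 1 : ℕ))) := by
    have e1 : ⁅c 1, c (n + 1)⁆ = -p := by
      rw [← lie_skew, ← hp 1, add_comm]
    have e2 : ⁅c (-n), c 0⁆ = -p := by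
      rw [← lie_skew, ← hp (-n), neg_add_cancel]
    have e3 : ⁅c 1, c (-(n + 1))⁆ = f (-(n + 1 : ℕ)) := by
      rw [hf]; push_cast; congr 2; ring
    rw [← hg 0, zero_add, leibniz_lie, hq', hq', hf, ← e3, smul_lie, lie_smul, sub_lie, lie_sub,
      show (1 : ℤ) - (n + 1) = -n by ring, zero_add, zero_add, zero_sub, e1, e2,
      show (1 : ℤ) + (n + 1) = n + 2 by ring]
    module
  have h3 : ⁅g, q⁆ = 0 := by
    rw [sub_eq_nsmul_of_sub_const h1', ← lie_skew, ← Nat.cast_smul_eq_nsmul F] at h2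
    have : ((n : F) + 2) • ⁅g, q⁆ = 0 := by
      rw [← sub_eq_zero] at h2
      rw [← neg_eq_zero, ← h2]
      push_cast
      module
    exact (smul_eq_zero.1 this).resolve_left (by exact_mod_cast (Nat.succ_ne_zero (n + 1)))
  refine ⟨h3, fun l => ?_⟩
  have := apply_eq_of_sub_pred_eq_zero (f := f) (fun l => by rw [h1', h3, smul_zero]) l
  rw [← hf, this, hf, zero_add]

/-- Two consecutive levels are carried because `onsager_relations_step` consumes both. -/
theorem onsager_relations_nat {c : ℤ → L} {g : L}
    (hrec : ∀ k, ⁅g, c k⁆ = (2 : F) • (c (k + 1) - c (k - 1)))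
    (hg : ∀ k, ⁅c (k + 1), c k⁆ = g) (n : ℕ) :
    ((∀ l : ℤ, ⁅c (l + n), c l⁆ = ⁅c n, c 0⁆) ∧
      ∀ l : ℤ, ⁅⁅c n, c 0⁆, c l⁆ = (2 : F) • (c (l + n) - c (l - n))) ∧
    ((∀ l : ℤ, ⁅c (l + (n + 1)), c l⁆ = ⁅c (n + 1), c 0⁆) ∧
      ∀ l : ℤ, ⁅⁅c (n + 1), c 0⁆, c l⁆ = (2 : F) • (c (l + (n + 1)) - c (l - (n + 1)))) := by
  induction n with
  | zero =>
    have := hg 0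
    rw [zero_add] at this
    simp [hg, hrec, this]
  | succ n ih =>
    obtain ⟨⟨hp, -⟩, hq, hq'⟩ := ih
    have h := (onsager_relations_step hrec hg hp hq hq').2
    push_cast
    rw [show (n : ℤ) + 1 + 1 = n + 2 by ring]
    refine ⟨⟨hq, hq'⟩, h, fun l => ?_⟩
    have e1 : ⁅c (l - (n + 1)), c l⁆ = -⁅c (n + 1), c 0⁆ := by
      rw [← lie_skew, ← hq (l - (n + 1)), sub_add_cancel]
    -- The representative `[c (l + 1), c (l - (n + 1))]` is chosen so that, after Jacobi, the inner
    -- brackets with `c l` have the known index differences `1` and `n + 1`.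
    rw [← h (l - (n + 1)), show l - (n + 1 : ℤ) + (n + 2) = l + 1 by ring, lie_lie,
      ← lie_skew (c (l + 1)) (c l), e1, lie_neg, lie_skew, hq', lie_skew, hg,
      ← lie_skew, hrec, show l - (n + 1 : ℤ) + 1 = l - n by ring, show l - (n + 1 : ℤ) - 1 = l - (n + 2) by ring,
      show l + 1 + (n + 1 : ℤ) = l + (n + 2) by ring, show l + 1 - (n + 1 : ℤ) = l - n by ring]
    module

/-- The Onsager relation `[c k, c l] = [c (k - l), c 0]`. -/
theorem onsager_lie_eq {c : ℤ → L} {g : L}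
    (hrec : ∀ k, ⁅g, c k⁆ = (2 : F) • (c (k + 1) - c (k - 1)))
    (hg : ∀ k, ⁅c (k + 1), c k⁆ = g) (k l : ℤ) : ⁅c k, c l⁆ = ⁅c (k - l), c 0⁆ := by
  obtain ⟨n, h | h⟩ := Int.eq_nat_or_neg (k - l)
  · rw [h, ← (onsager_relations_nat hrec hg n).1.1 l, ← h, add_sub_cancel]
  · have h' := (onsager_relations_nat hrec hg n).1.1
    rw [h, ← lie_skew, ← lie_skew (c (-n)), ← zero_add (-(n : ℤ))]
    have e1 := h' k
    have e2 := h' (0 + -n)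
    rw [show k + (n : ℤ) = l by linarith] at e1
    rw [neg_add_cancel_right] at e2
    rw [e1, e2]

/-- The Onsager relation `[[c m, c 0], c l] = 2 (c (l + m) - c (l - m))`. -/
theorem onsager_lie_lie_eq {c : ℤ → L} {g : L}
    (hrec : ∀ k, ⁅g, c k⁆ = (2 : F) • (c (k + 1) - c (k - 1)))
    (hg : ∀ k, ⁅c (k + 1), c k⁆ = g) (m l : ℤ) :
    ⁅⁅c m, c 0⁆, c l⁆ = (2 : F) • (c (l + m) - c (l - m)) := by
  obtain ⟨n, rfl | rfl⟩ := Int.eq_nat_or_neg m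
  · exact (onsager_relations_nat hrec hg n).1.2 l
  · have h : ⁅c (-n), c 0⁆ = -⁅c n, c 0⁆ := by
      rw [← lie_skew, onsager_lie_eq hrec hg 0 (-n), sub_neg_eq_add, zero_add]
    rw [h, neg_lie, (onsager_relations_nat hrec hg n).1.2 l, sub_neg_eq_add, ← sub_eq_add_neg]
    module

end OnsagerRelations

/-! ### Spanning sets of the Onsager algebra -/

namespace Onsager

variable (F : Type*) [Field F]

/-- The quotient map from the free Lie algebra, as a Lie algebra homomorphism. -/
noncomputable def mkHom : FreeLieAlgebra F OnsagerGen →ₗ⁅F⁆ Onsager F where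
  toLinearMap := (dolanGradyIdeal F).toSubmodule.mkQ
  map_lie' := by intro x y; rfl

theorem mkHom_surjective : Function.Surjective (mkHom F) :=
  Submodule.mkQ_surjective _

theorem mkHom_relator {v : FreeLieAlgebra F OnsagerGen} (hv : v ∈ dolanGradyRelators F) :
    mkHom F v = 0 :=
  (LieSubmodule.Quotient.mk_eq_zero' (N := dolanGradyIdeal F)).2 (LieSubmodule.subset_lieSpan hv)

theorem lie_A_lie_A_lie_A_B : ⁅A F, ⁅A F, ⁅A F, B F⁆⁆⁆ = (4 : F) • ⁅A F, B F⁆ := by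
  have h := mkHom_relator F (Or.inl rfl)
  rw [map_sub, sub_eq_zero, map_smul] at h
  simp only [LieHom.map_lie] at h
  exact h

theorem lie_B_lie_B_lie_B_A : ⁅B F, ⁅B F, ⁅B F, A F⁆⁆⁆ = (4 : F) • ⁅B F, A F⁆ := by
  have h := mkHom_relator F (Or.inr rfl)
  rw [map_sub, sub_eq_zero, map_smul] at h
  simp only [LieHom.map_lie] at h
  exact h

variable {F}

theorem lieSubalgebra_eq_top {K : LieSubalgebra F (Onsager F)} (hA : A F ∈ K) (hB : B F ∈ K) :
    K = ⊤ := by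
  let g : OnsagerGen → K
    | OnsagerGen.A => ⟨A F, hA⟩
    | OnsagerGen.B => ⟨B F, hB⟩
  have h : K.incl.comp (FreeLieAlgebra.lift F g) = mkHom F := by
    refine FreeLieAlgebra.hom_ext fun x => ?_
    rw [LieHom.comp_apply, FreeLieAlgebra.lift_of_apply]
    cases x <;> rfl
  refine eq_top_iff.2 fun x _ => ?_
  obtain ⟨v, rfl⟩ := mkHom_surjective F x
  rw [← h]
  exact (FreeLieAlgebra.lift F g v).2

/-- The elements whose `ad` preserves `S` form a Lie subalgebra containing the generators, hence
everything; so `S` is itself a subalgebra containing the generators. -/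
theorem submodule_eq_top {S : Submodule F (Onsager F)} (hA : A F ∈ S) (hB : B F ∈ S)
    (hlA : ∀ s ∈ S, ⁅A F, s⁆ ∈ S) (hlB : ∀ s ∈ S, ⁅B F, s⁆ ∈ S) : S = ⊤ := by
  let N : LieSubalgebra F (Onsager F) :=
    { carrier := {x | ∀ s ∈ S, ⁅x, s⁆ ∈ S}
      add_mem' := fun {x y} hx hy s hs => by
        rw [add_lie]; exact S.add_mem (hx s hs) (hy s hs)
      zero_mem' := fun s _ => by rw [zero_lie]; exact S.zero_mem
      smul_mem' := fun r x hx s hs => by rw [smul_lie]; exact S.smul_mem r (hx s hs)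
      lie_mem' := fun {x y} hx hy s hs => by
        rw [lie_lie]; exact S.sub_mem (hx _ (hy s hs)) (hy _ (hx s hs)) }
  have hN : N = ⊤ := lieSubalgebra_eq_top hlA hlB
  let K : LieSubalgebra F (Onsager F) :=
    { S with
      lie_mem' := fun {x y} _ hy => by
        have hx : x ∈ N := hN ▸ LieSubalgebra.mem_top x
        exact hx y hy }
  have hK : K = ⊤ := lieSubalgebra_eq_top hA hB
  exact eq_top_iff.2 fun x _ => (hK ▸ LieSubalgebra.mem_top x : x ∈ K)

variable (F) in
/-- The Onsager generators `A_k`, `k ∈ ℤ`, normalized by `A_0 = A`, `A_1 = B`. -/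
noncomputable def seq : ℤ → Onsager F := onsagerSeq F (A F) (B F)

variable [CharZero F]

theorem lie_seq (k : ℤ) :
    ⁅⁅B F, A F⁆, seq F k⁆ = (2 : F) • (seq F (k + 1) - seq F (k - 1)) :=
  lie_onsagerSeq _ _ k

theorem lie_seq_succ (k : ℤ) : ⁅seq F (k + 1), seq F k⁆ = ⁅B F, A F⁆ :=
  (lie_onsagerSeq_succ_aux (lie_A_lie_A_lie_A_B F) (lie_B_lie_B_lie_B_A F) k).1

/-- A subspace that contains all `A_k` and all `[A_k, A_0]` is everything. -/
theorem submodule_eq_top_of_seq_mem {S : Submodule F (Onsager F)} (h1 : ∀ k, seq F k ∈ S)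
    (h2 : ∀ k, ⁅seq F k, A F⁆ ∈ S) : S = ⊤ := by
  -- `S` is not known to be stable under brackets; the span `T` of the given elements is, by
  -- Onsager's relations.
  obtain ⟨T, hT⟩ : ∃ T, T = Submodule.span F
    (Set.range (seq F) ∪ Set.range fun k => ⁅seq F k, A F⁆) := ⟨_, rfl⟩
  have hTS : T ≤ S := by
    rw [hT, Submodule.span_le]
    rintro _ (⟨k, rfl⟩ | ⟨k, rfl⟩)
    exacts [h1 k, h2 k]
  have m1 (k) : seq F k ∈ T := hT ▸ Submodule.subset_span (Or.inl ⟨k, rfl⟩)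
  have m2 (k) : ⁅seq F k, A F⁆ ∈ T := hT ▸ Submodule.subset_span (Or.inr ⟨k, rfl⟩)
  have hlie (j : ℤ) : ∀ s ∈ T, ⁅seq F j, s⁆ ∈ T := by
    intro s hs
    rw [hT] at hs
    induction hs using Submodule.span_induction with
    | mem x hx =>
      obtain ⟨k, rfl⟩ | ⟨k, rfl⟩ := hx
      · rw [onsager_lie_eq lie_seq lie_seq_succ]
        exact m2 _
      · rw [← lie_skew]
        have := onsager_lie_lie_eq (F := F) lie_seq lie_seq_succ k j
        change ⁅⁅seq F k, A F⁆, seq F j⁆ = _ at this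
        rw [this]
        exact T.neg_mem (T.smul_mem _ (T.sub_mem (m1 _) (m1 _)))
    | zero => rw [lie_zero]; exact T.zero_mem
    | add x y _ _ hx hy => rw [lie_add]; exact T.add_mem hx hy
    | smul r x _ hx => rw [lie_smul]; exact T.smul_mem r hx
  have e0 : seq F 0 = A F := onsagerSeq_zero _ _
  have e1 : seq F 1 = B F := onsagerSeq_one _ _
  refine top_le_iff.1 (le_trans (ge_of_eq (submodule_eq_top ?_ ?_ ?_ ?_)) hTS)
  · exact e0 ▸ m1 0
  · exact e1 ▸ m1 1
  · exact e0 ▸ hlie 0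
  · exact e1 ▸ hlie 1

end Onsager

/-! ### The difference operator that corresponds to multiplication by `t - 1` -/

section SeqShift

variable (F : Type*) {M N : Type*} [Field F] [AddCommGroup M] [Module F M] [AddCommGroup N]
  [Module F N]

/-- The operator `(W c) k = -(c (k + 1) + 2 c k + c (k - 1)) / 4` on two-sided sequences. -/
def seqShift (c : ℤ → M) : ℤ → M :=
  fun k => -(4⁻¹ : F) • (c (k + 1) + (2 : F) • c k + c (k - 1))

variable {F}

theorem seqShift_iterate_succ (c : ℤ → M) (i : ℕ) (k : ℤ) :
    (seqShift F)^[i + 1] c k = -(4⁻¹ : F) • ((seqShift F)^[i] c (k + 1) +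
      (2 : F) • (seqShift F)^[i] c k + (seqShift F)^[i] c (k - 1)) := by
  rw [Function.iterate_succ_apply']
  rfl

/-- A sequence is spanned by the entries at `0` and `1` of its iterates under `W`. -/
theorem mem_of_seqShift_iterate_mem [CharZero F] {c : ℤ → M} {S : Submodule F M}
    (h0 : ∀ i, (seqShift F)^[i] c 0 ∈ S) (h1 : ∀ i, (seqShift F)^[i] c 1 ∈ S) (k : ℤ) :
    c k ∈ S := by
  -- All iterates are treated together: moving `k` by one uses the iterate `i + 1`.
  suffices h : ∀ i, (seqShift F)^[i] c k ∈ S ∧ (seqShift F)^[i] c (k + 1) ∈ S from (h 0).1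
  induction k using Int.induction_on with
  | zero => exact fun i => ⟨h0 i, by simpa using h1 i⟩
  | succ k ih =>
    refine fun i => ⟨(ih i).2, ?_⟩
    have h := seqShift_iterate_succ (F := F) c i (k + 1)
    rw [add_sub_cancel_right] at h
    have e : (seqShift F)^[i] c (k + 1 + 1) = -(4 : F) • (seqShift F)^[i + 1] c (k + 1) -
        (2 : F) • (seqShift F)^[i] c (k + 1) - (seqShift F)^[i] c k := by
      rw [h]; module
    rw [e]
    exact S.sub_mem (S.sub_mem (S.smul_mem _ (ih _).2) (S.smul_mem _ (ih _).2)) (ih _).1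
  | pred k ih =>
    refine fun i => ⟨?_, by simpa using (ih i).1⟩
    have h := seqShift_iterate_succ (F := F) c i (-k)
    have e : (seqShift F)^[i] c (-k - 1) = -(4 : F) • (seqShift F)^[i + 1] c (-k) -
        (2 : F) • (seqShift F)^[i] c (-k) - (seqShift F)^[i] c (-k + 1) := by
      rw [h]; module
    rw [e]
    exact S.sub_mem (S.sub_mem (S.smul_mem _ (ih _).1) (S.smul_mem _ (ih _).1)) (ih _).2

theorem seqShift_iterate_odd {c : ℤ → M} (hc : ∀ k, c (-k) = -c k) (i : ℕ) (k : ℤ) :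
    (seqShift F)^[i] c (-k) = -(seqShift F)^[i] c k := by
  induction i generalizing k with
  | zero => exact hc k
  | succ i ih =>
    rw [seqShift_iterate_succ, seqShift_iterate_succ, ih, show -k + 1 = -(k - 1) by ring, ih,
      show -k - 1 = -(k + 1) by ring, ih]
    module

/-- The hypothesis on `c` alone suffices, since the scalar `w` commutes with the `F`-linear operator
`seqShift`. -/
theorem map_seqShift_iterate {R : Type*} [Monoid R] [DistribMulAction R N] [SMulCommClass R F N]
    {c : ℤ → M} (f : M →ₗ[F] N) {w : R} (h : ∀ k, f (seqShift F c k) = w • f (c k)) (i : ℕ)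
    (k : ℤ) : f ((seqShift F)^[i] c k) = w ^ i • f (c k) := by
  induction i generalizing k with
  | zero => simp
  | succ i ih =>
    rw [seqShift_iterate_succ, map_smul, map_add, map_add, map_smul, ih, ih, ih, pow_succ, mul_smul,
      ← h, seqShift, map_smul, map_add, map_add, map_smul]
    simp only [smul_add, smul_comm (w ^ i)]

end SeqShift

noncomputable section

/-! ### Bracket relations in the three-point loop algebra -/

section Loop

variable (F : Type*) [Field F]

/-- With its analogues for `Bup` and `psiUp`, this reduces every bracket relation to index `0` by
`𝒜`-bilinearity. -/
theorem Aup_eq_smul (i : ℕ) : Aup F i = (ThreePointRing.t F - 1) ^ i • Aup F 0 := by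
  simp [Aup, TensorProduct.smul_tmul']

theorem Bup_eq_smul (i : ℕ) : Bup F i = (ThreePointRing.t F - 1) ^ i • Bup F 0 := by
  simp [Bup]

theorem psiUp_eq_smul (i : ℕ) : psiUp F i = (ThreePointRing.t F - 1) ^ i • psiUp F 0 := by
  simp [psiUp, TensorProduct.smul_tmul']

theorem Bup_zero : Bup F 0 = ThreePointRing.t F ⊗ₜ[F] SlTwo.y F +
    (ThreePointRing.t F - 1) ⊗ₜ[F] SlTwo.z F := by
  simp [Bup]

namespace ThreePointLoop

variable {F}

theorem add_lie (u v w : ThreePointLoop F) : ⁅u + v, w⁆ = ⁅u, w⁆ + ⁅v, w⁆ :=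
  _root_.add_lie u v w

theorem lie_add (u v w : ThreePointLoop F) : ⁅u, v + w⁆ = ⁅u, v⁆ + ⁅u, w⁆ :=
  _root_.lie_add u v w

theorem lie_self (u : ThreePointLoop F) : ⁅u, u⁆ = 0 :=
  _root_.lie_self u

theorem lie_skew (u v : ThreePointLoop F) : -⁅u, v⁆ = ⁅v, u⁆ :=
  _root_.lie_skew v u

theorem smul_lie (r : ThreePointRing F) (u v : ThreePointLoop F) : ⁅r • u, v⁆ = r • ⁅u, v⁆ :=
  _root_.smul_lie r u v

theorem lie_smul (r : ThreePointRing F) (u v : ThreePointLoop F) : ⁅u, r • v⁆ = r • ⁅u, v⁆ :=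
  _root_.lie_smul r u v

theorem sub_one_tmul (u : SlTwo F) :
    (ThreePointRing.t F - 1) ⊗ₜ[F] u = ThreePointRing.t F ⊗ₜ[F] u - 1 ⊗ₜ[F] u :=
  TensorProduct.sub_tmul _ _ _

end ThreePointLoop

theorem lie_psiUp_zero_Aup_zero :
    ⁅psiUp F 0, Aup F 0⁆ = (2 : F) • psiUp F 0 + (2 : F) • Aup F 0 := by
  simp only [psiUp, Aup, LieAlgebra.ExtendScalars.bracket_tmul, SlTwo.lie_z_x, pow_zero, mul_one,
    TensorProduct.tmul_add, TensorProduct.tmul_smul]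

theorem SlTwo.lie_x_z : ⁅SlTwo.x F, SlTwo.z F⁆ = -((2 : F) • SlTwo.z F + (2 : F) • SlTwo.x F) := by
  rw [← SlTwo.lie_z_x, lie_skew]

theorem lie_Bup_zero_psiUp_zero :
    ⁅Bup F 0, psiUp F 0⁆ = (2 : F) • Bup F 0 + (2 : F) • psiUp F 0 := by
  simp only [psiUp, Bup_zero, LieAlgebra.ExtendScalars.bracket_tmul, SlTwo.lie_y_z, pow_zero,
    mul_one, TensorProduct.tmul_add, TensorProduct.tmul_smul, ThreePointLoop.add_lie, lie_self,
    TensorProduct.tmul_zero]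
  simp only [ThreePointLoop.sub_one_tmul]
  module

theorem lie_Aup_zero_Bup_zero :
    ⁅Aup F 0, Bup F 0⁆ = (2 : F) • Aup F 0 + (2 : F) • Bup F 0 - (4 : F) • psiUp F 1 := by
  simp only [psiUp, Aup, Bup_zero, LieAlgebra.ExtendScalars.bracket_tmul, SlTwo.lie_x_y,
    SlTwo.lie_x_z, pow_zero, pow_one, one_mul, TensorProduct.tmul_add, TensorProduct.tmul_smul,
    ThreePointLoop.lie_add, TensorProduct.tmul_neg]
  simp only [ThreePointLoop.sub_one_tmul]
  module

theorem lie_Aup_Aup (i j : ℕ) : ⁅Aup F i, Aup F j⁆ = 0 := by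
  rw [Aup_eq_smul F i, Aup_eq_smul F j, ThreePointLoop.smul_lie, ThreePointLoop.lie_smul,
    ThreePointLoop.lie_self, smul_zero, smul_zero]

theorem lie_Bup_Bup (i j : ℕ) : ⁅Bup F i, Bup F j⁆ = 0 := by
  rw [Bup_eq_smul F i, Bup_eq_smul F j, ThreePointLoop.smul_lie, ThreePointLoop.lie_smul,
    ThreePointLoop.lie_self, smul_zero, smul_zero]

theorem lie_psiUp_psiUp (i j : ℕ) : ⁅psiUp F i, psiUp F j⁆ = 0 := by
  rw [psiUp_eq_smul F i, psiUp_eq_smul F j, ThreePointLoop.smul_lie, ThreePointLoop.lie_smul,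
    ThreePointLoop.lie_self, smul_zero, smul_zero]

theorem lie_psiUp_Aup (i j : ℕ) :
    ⁅psiUp F i, Aup F j⁆ = (2 : F) • psiUp F (i + j) + (2 : F) • Aup F (i + j) := by
  rw [psiUp_eq_smul F i, Aup_eq_smul F j, psiUp_eq_smul F (i + j), Aup_eq_smul F (i + j), ThreePointLoop.smul_lie,
    ThreePointLoop.lie_smul, smul_smul, ← pow_add, lie_psiUp_zero_Aup_zero, smul_add,
    smul_comm (2 : F), smul_comm (2 : F)]

theorem lie_Bup_psiUp (i j : ℕ) :
    ⁅Bup F i, psiUp F j⁆ = (2 : F) • Bup F (i + j) + (2 : F) • psiUp F (i + j) := by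
  rw [psiUp_eq_smul F j, Bup_eq_smul F i, psiUp_eq_smul F (i + j), Bup_eq_smul F (i + j), ThreePointLoop.smul_lie,
    ThreePointLoop.lie_smul, smul_smul, ← pow_add, lie_Bup_zero_psiUp_zero, smul_add,
    smul_comm (2 : F), smul_comm (2 : F)]

theorem lie_Aup_Bup (i j : ℕ) :
    ⁅Aup F i, Bup F j⁆ =
      (2 : F) • Aup F (i + j) + (2 : F) • Bup F (i + j) - (4 : F) • psiUp F (i + j + 1) := by
  rw [Aup_eq_smul F i, Bup_eq_smul F j, Aup_eq_smul F (i + j), Bup_eq_smul F (i + j),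
    psiUp_eq_smul F (i + j + 1), ThreePointLoop.smul_lie, ThreePointLoop.lie_smul, smul_smul,
    ← pow_add, lie_Aup_zero_Bup_zero,
    smul_sub, smul_add, smul_comm (2 : F), smul_comm (2 : F), smul_comm (4 : F),
    psiUp_eq_smul F 1, smul_comm (4 : F), smul_smul, ← pow_add]

theorem onsagerToLoop_A : onsagerToLoop F (Onsager.A F) = Aup F 0 := by
  change FreeLieAlgebra.lift F (onsagerGenToLoop F) (FreeLieAlgebra.of F OnsagerGen.A) = _
  rw [FreeLieAlgebra.lift_of_apply]
  simp [onsagerGenToLoop, Aup]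

theorem onsagerToLoop_B : onsagerToLoop F (Onsager.B F) = Bup F 0 := by
  change FreeLieAlgebra.lift F (onsagerGenToLoop F) (FreeLieAlgebra.of F OnsagerGen.B) = _
  rw [FreeLieAlgebra.lift_of_apply]
  simp [onsagerGenToLoop, Bup]

end Loop

/-! ### The image of the Onsager sequence in the loop algebra -/

section Image

variable {F : Type*} [Field F] [CharZero F]

/-- A sequence with `[g, c k] = 2 (c (k + 1) - c (k - 1))` whose first two terms generate the bracket
relations of `A↑↑_0`, `B↑↑_0`, `ψ↑↑_0` satisfies a three-term recurrence over `R`. -/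
theorem three_term_recurrence {R L : Type*} [CommRing R] [LieRing L] [LieAlgebra F L]
    [LieAlgebra R L] [SMulCommClass R F L] {w : R} {c : ℤ → L} {g z : L}
    (hrec : ∀ k, ⁅g, c k⁆ = (2 : F) • (c (k + 1) - c (k - 1))) (hg : ⁅c 1, c 0⁆ = g)
    (hgz : g = -((2 : F) • c 0 + (2 : F) • c 1 - (4 : F) • w • z))
    (hz0 : ⁅z, c 0⁆ = (2 : F) • z + (2 : F) • c 0)
    (hz1 : ⁅c 1, z⁆ = (2 : F) • c 1 + (2 : F) • z) (k : ℤ) :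
    c (k + 1) + (2 : F) • c k + c (k - 1) + (4 : F) • w • c k = 0 := by
  have hg0 : ⁅g, c 0⁆ = (4 : F) • c 0 + (4 : F) • c 1 + (8 : F) • w • c 0 := by
    rw [hgz, neg_lie, sub_lie, add_lie, smul_lie, smul_lie, smul_lie, smul_lie, lie_self, hg, hgz,
      hz0, smul_add, smul_comm w (2 : F), smul_comm w (2 : F)]
    generalize w • z = v
    generalize w • c 0 = v'
    module
  have hg1 : ⁅g, c 1⁆ = -((4 : F) • c 0 + (4 : F) • c 1 + (8 : F) • w • c 1) := by
    rw [hgz, neg_lie, sub_lie, add_lie, smul_lie, smul_lie, smul_lie, smul_lie, lie_self,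
      ← lie_skew (c 0), hg, hgz, ← lie_skew z, hz1, smul_neg w, smul_add w, smul_comm w (2 : F),
      smul_comm w (2 : F)]
    generalize w • z = v
    generalize w • c 1 = v'
    module
  -- The defect `e` obeys the same second-order recurrence as `c`, because `ad g` commutes with `w`;
  -- it therefore vanishes once `e 0 = e 1 = 0`.
  obtain ⟨e, he⟩ : ∃ e : ℤ → L, ∀ k, e k = c (k + 1) + (2 : F) • c k + c (k - 1) +
    (4 : F) • w • c k := ⟨_, fun _ => rfl⟩
  have hrec' (k : ℤ) : ⁅g, e k⁆ = (2 : F) • (e (k + 1) - e (k - 1)) := by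
    simp only [he, lie_add, lie_smul, hrec, sub_add_cancel, add_sub_cancel_right]
    rw [smul_comm w (2 : F), smul_sub w]
    generalize w • c (k + 1) = v
    generalize w • c (k - 1) = v'
    module
  have h0 := hrec 0
  have h1 := hrec 1
  have e0 : e 0 = 0 := by
    have hm : c (-1) = c 1 - (2⁻¹ : F) • ⁅g, c 0⁆ := by
      rw [h0, zero_add, zero_sub]; module
    rw [he, zero_add, zero_sub, hm, hg0]
    generalize w • c 0 = v
    module
  have e1 : e 1 = 0 := by
    have hm : c (1 + 1) = c 0 + (2⁻¹ : F) • ⁅g, c 1⁆ := by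
      rw [h1, sub_self]; module
    rw [he, sub_self, hm, hg1]
    generalize w • c 1 = v
    module
  suffices h : e k = 0 ∧ e (k + 1) = 0 by rw [← h.1, he]
  induction k using Int.induction_on with
  | zero => exact ⟨e0, by rw [zero_add, e1]⟩
  | succ k ih =>
    refine ⟨ih.2, ?_⟩
    have h := hrec' (k + 1)
    rw [ih.2, lie_zero, add_sub_cancel_right, ih.1, sub_zero] at h
    exact (smul_eq_zero.1 h.symm).resolve_left two_ne_zero
  | pred k ih =>
    rw [sub_add_cancel]
    refine ⟨?_, ih.1⟩
    have h := hrec' (-k)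
    rw [ih.1, lie_zero, ih.2, zero_sub, smul_neg, eq_comm, neg_eq_zero] at h
    exact (smul_eq_zero.1 h).resolve_left two_ne_zero

/-- The image of the sequence `A_k` satisfies a three-term recurrence over `𝒜`. -/
theorem onsagerToLoop_seq_recurrence (k : ℤ) :
    onsagerToLoop F (Onsager.seq F (k + 1)) + (2 : F) • onsagerToLoop F (Onsager.seq F k) +
      onsagerToLoop F (Onsager.seq F (k - 1)) +
      (4 : F) • (ThreePointRing.t F - 1) • onsagerToLoop F (Onsager.seq F k) = 0 := by
  have c0 : onsagerToLoop F (Onsager.seq F 0) = Aup F 0 := by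
    rw [← onsagerToLoop_A]; exact congrArg _ (onsagerSeq_zero _ _)
  have c1 : onsagerToLoop F (Onsager.seq F 1) = Bup F 0 := by
    rw [← onsagerToLoop_B]; exact congrArg _ (onsagerSeq_one _ _)
  refine three_term_recurrence (R := ThreePointRing F) (w := ThreePointRing.t F - 1)
    (c := fun k => onsagerToLoop F (Onsager.seq F k))
    (g := onsagerToLoop F ⁅Onsager.B F, Onsager.A F⁆) (z := psiUp F 0)
    (fun k => ?_) ?_ ?_ ?_ ?_ k
  · rw [← map_sub, ← map_smul, ← Onsager.lie_seq]
    exact (LieHom.map_lie _ _ _).symm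
  · rw [LieHom.map_lie, onsagerToLoop_A, onsagerToLoop_B, c0, c1]
  · rw [LieHom.map_lie, onsagerToLoop_A, onsagerToLoop_B, c0, c1, ← ThreePointLoop.lie_skew,
      lie_Aup_zero_Bup_zero, psiUp_eq_smul F 1, pow_one]
  · rw [c0]; exact lie_psiUp_zero_Aup_zero F
  · rw [c1]; exact lie_Bup_zero_psiUp_zero F

theorem onsagerToLoop_seqShift_seq (k : ℤ) :
    onsagerToLoop F (seqShift F (Onsager.seq F) k) =
      (ThreePointRing.t F - 1) • onsagerToLoop F (Onsager.seq F k) := by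
  have h := onsagerToLoop_seq_recurrence (F := F) k
  rw [seqShift, map_smul, map_add, map_add, map_smul, eq_neg_of_add_eq_zero_left h]
  generalize (ThreePointRing.t F - 1) • onsagerToLoop F (Onsager.seq F k) = v
  module

variable (F) in
/-- The sequence `[A_k, A_0]` in the Onsager algebra. -/
def Onsager.lieSeq (k : ℤ) : Onsager F := ⁅Onsager.seq F k, Onsager.A F⁆

theorem onsagerToLoop_seqShift_lieSeq (k : ℤ) :
    onsagerToLoop F (seqShift F (Onsager.lieSeq F) k) =
      (ThreePointRing.t F - 1) • onsagerToLoop F (Onsager.lieSeq F k) := by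
  have h : seqShift F (Onsager.lieSeq F) k = ⁅seqShift F (Onsager.seq F) k, Onsager.A F⁆ := by
    simp only [seqShift, Onsager.lieSeq, smul_lie, add_lie]
  rw [h, LieHom.map_lie, onsagerToLoop_seqShift_seq, ThreePointLoop.smul_lie, Onsager.lieSeq, LieHom.map_lie]

variable (F) in
/-- The basis of the Onsager algebra that corresponds to `A↑↑`, `B↑↑`, `ψ↑↑`. -/
def Onsager.upFamily : ℕ ⊕ ℕ ⊕ ℕ → Onsager F
  | Sum.inl i => (seqShift F)^[i] (seq F) 0
  | Sum.inr (Sum.inl i) => (seqShift F)^[i] (seq F) 1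
  -- This is `[A_0, B_i] = 2 A_i + 2 B_i - 4 ψ_{i+1}` solved for `ψ_{i+1}`.
  | Sum.inr (Sum.inr i) => (4⁻¹ : F) • ((seqShift F)^[i] (lieSeq F) 1 +
      (2 : F) • (seqShift F)^[i] (seq F) 0 + (2 : F) • (seqShift F)^[i] (seq F) 1)

/-- The sequence `lieSeq` is odd, so its iterates vanish at `0`; their entries at `1` are recovered
from the third family. -/
theorem Onsager.span_upFamily : Submodule.span F (Set.range (upFamily F)) = ⊤ := by
  have h0 (i) : (seqShift F)^[i] (seq F) 0 ∈ Submodule.span F (Set.range (upFamily F)) :=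
    Submodule.subset_span ⟨Sum.inl i, rfl⟩
  have h1 (i) : (seqShift F)^[i] (seq F) 1 ∈ Submodule.span F (Set.range (upFamily F)) :=
    Submodule.subset_span ⟨Sum.inr (Sum.inl i), rfl⟩
  have hodd (k : ℤ) : lieSeq F (-k) = -lieSeq F k := by
    have h := onsager_lie_eq (F := F) lie_seq lie_seq_succ 0 k
    rw [zero_sub] at h
    change _ = lieSeq F (-k) at h
    rw [← h, ← lie_skew]
    rfl
  refine submodule_eq_top_of_seq_mem (mem_of_seqShift_iterate_mem h0 h1)
    (mem_of_seqShift_iterate_mem (c := lieSeq F) (fun i => ?_) fun i => ?_)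
  · have h := seqShift_iterate_odd (F := F) hodd i 0
    rw [neg_zero, eq_neg_iff_add_eq_zero, ← two_smul F] at h
    rw [(smul_eq_zero.1 h).resolve_left two_ne_zero]
    exact Submodule.zero_mem _
  · have h : (seqShift F)^[i] (lieSeq F) 1 = (4 : F) • upFamily F (Sum.inr (Sum.inr i)) -
        ((2 : F) • (seqShift F)^[i] (seq F) 0 + (2 : F) • (seqShift F)^[i] (seq F) 1) := by
      rw [upFamily]; module
    rw [h]
    exact Submodule.sub_mem _ (Submodule.smul_mem _ _ (Submodule.subset_span ⟨_, rfl⟩))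
      (Submodule.add_mem _ (Submodule.smul_mem _ _ (h0 i)) (Submodule.smul_mem _ _ (h1 i)))

theorem onsagerToLoop_upFamily_A (i : ℕ) :
    onsagerToLoop F (Onsager.upFamily F (Sum.inl i)) = Aup F i := by
  have h := map_seqShift_iterate (onsagerToLoop F : Onsager F →ₗ[F] ThreePointLoop F)
    onsagerToLoop_seqShift_seq i 0
  rw [Aup_eq_smul, ← onsagerToLoop_A]
  exact h

theorem onsagerToLoop_upFamily_B (i : ℕ) :
    onsagerToLoop F (Onsager.upFamily F (Sum.inr (Sum.inl i))) = Bup F i := by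
  have h := map_seqShift_iterate (onsagerToLoop F : Onsager F →ₗ[F] ThreePointLoop F)
    onsagerToLoop_seqShift_seq i 1
  rw [Onsager.seq, onsagerSeq_one] at h
  rw [Bup_eq_smul, ← onsagerToLoop_B]
  exact h

theorem onsagerToLoop_upFamily_psi (i : ℕ) :
    onsagerToLoop F (Onsager.upFamily F (Sum.inr (Sum.inr i))) = psiUp F (i + 1) := by
  have hA : onsagerToLoop F ((seqShift F)^[i] (Onsager.seq F) 0) = Aup F i :=
    onsagerToLoop_upFamily_A i
  have hB : onsagerToLoop F ((seqShift F)^[i] (Onsager.seq F) 1) = Bup F i :=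
    onsagerToLoop_upFamily_B i
  have h : onsagerToLoop F ((seqShift F)^[i] (Onsager.lieSeq F) 1) =
      -((2 : F) • Aup F i + (2 : F) • Bup F i - (4 : F) • psiUp F (i + 1)) := by
    refine (map_seqShift_iterate (onsagerToLoop F : Onsager F →ₗ[F] ThreePointLoop F)
      onsagerToLoop_seqShift_lieSeq i 1).trans ?_
    have h := lie_Aup_Bup F 0 i
    rw [zero_add] at h
    rw [← h, ThreePointLoop.lie_skew, Bup_eq_smul, ThreePointLoop.smul_lie, ← onsagerToLoop_A, ← onsagerToLoop_B,
      ← LieHom.map_lie, Onsager.lieSeq, Onsager.seq, onsagerSeq_one]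
    rfl
  rw [Onsager.upFamily, map_smul, map_add, map_add, map_smul, map_smul, h, hA, hB]
  module

end Image

/-! ### Linear independence in the three-point loop algebra -/

section Independence

variable (F : Type*) [Field F]

theorem ThreePointRing.powers_le_nonZeroDivisors :
    Submonoid.powers (Polynomial.X * (Polynomial.X - 1) : F[X]) ≤ nonZeroDivisors F[X] :=
  powers_le_nonZeroDivisors_of_noZeroDivisors (mul_ne_zero Polynomial.X_ne_zero
    (by rw [← Polynomial.C_1]; exact Polynomial.X_sub_C_ne_zero 1))

theorem ThreePointRing.algebraMap_injective :
    Function.Injective (algebraMap F[X] (ThreePointRing F)) :=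
  IsLocalization.injective _ (powers_le_nonZeroDivisors F)

theorem ThreePointRing.isDomain : IsDomain (ThreePointRing F) :=
  IsLocalization.isDomain_localization (powers_le_nonZeroDivisors F)

theorem ThreePointRing.t_ne_zero : ThreePointRing.t F ≠ 0 :=
  (map_ne_zero_iff _ (algebraMap_injective F)).2 Polynomial.X_ne_zero

theorem ThreePointRing.transcendental_t_sub_one : Transcendental F (ThreePointRing.t F - 1) := by
  have h : Transcendental F (ThreePointRing.t F) :=
    (transcendental_algebraMap_iff (algebraMap_injective F)).2 (Polynomial.transcendental_X F)
  exact fun h' => h (by simpa using h'.add (isAlgebraic_one (R := F)))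

theorem ThreePointRing.t_sub_one_ne_zero : ThreePointRing.t F - 1 ≠ 0 :=
  fun h => transcendental_t_sub_one F (h ▸ isAlgebraic_zero)

/-- The map `p ↦ r * p(t - 1)` on polynomials is injective: `𝒜` is a domain and `t - 1` is
transcendental. -/
theorem ThreePointRing.linearIndependent_mul_pow {r : ThreePointRing F} (hr : r ≠ 0) :
    LinearIndependent F fun i : ℕ => r * (ThreePointRing.t F - 1) ^ i := by
  have := isDomain F
  have h := (Polynomial.basisMonomials F).linearIndependent.map'
    (LinearMap.mulLeft F r ∘ₗ (Polynomial.aeval (ThreePointRing.t F - 1)).toLinearMap)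
    (LinearMap.ker_eq_bot.2 ((mul_right_injective₀ hr).comp
      (transcendental_iff_injective.1 (transcendental_t_sub_one F))))
  have e : (fun i : ℕ => r * (ThreePointRing.t F - 1) ^ i) = (LinearMap.mulLeft F r ∘ₗ
      (Polynomial.aeval (ThreePointRing.t F - 1)).toLinearMap) ∘ Polynomial.basisMonomials F := by
    funext i
    simp
  exact e ▸ h

/-- The matrix entry `(i, j)` on the loop algebra, with values in `𝒜`. -/
def ThreePointLoop.entry (i j : Fin 2) : ThreePointLoop F →ₗ[F] ThreePointRing F :=
  (TensorProduct.rid F (ThreePointRing F)).toLinearMap ∘ₗ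
    LinearMap.lTensor (ThreePointRing F)
      { toFun := fun u : SlTwo F => u.1 i j
        map_add' := fun _ _ => rfl
        map_smul' := fun _ _ => rfl }

theorem ThreePointLoop.entry_tmul (i j : Fin 2) (r : ThreePointRing F) (u : SlTwo F) :
    entry F i j (r ⊗ₜ[F] u) = u.1 i j • r := rfl

/-- Coordinates on the loop algebra in which the family `A↑↑`, `B↑↑`, `ψ↑↑` splits. -/
def ThreePointLoop.coords :
    ThreePointLoop F →ₗ[F] ThreePointRing F × ThreePointRing F × ThreePointRing F :=
  (entry F 0 1).prod ((entry F 1 0).prod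
    -- On `x` both `2 * entry 0 0 + entry 0 1` and `entry 1 0` vanish; on `B↑↑_0` they are `-2` and
    -- `-2t`, whence the factor `t`. Only the `ψ↑↑` survive.
    (LinearMap.mulLeft F (ThreePointRing.t F) ∘ₗ ((2 : F) • entry F 0 0 + entry F 0 1) -
      entry F 1 0))

theorem ThreePointLoop.coords_Aup (i : ℕ) :
    coords F (Aup F i) = (2 * (ThreePointRing.t F - 1) ^ i, 0, 0) := by
  simp [coords, Aup, entry_tmul, SlTwo.x, SlTwo.e, SlTwo.h, ofNat_smul_eq_nsmul]

theorem Bup_eq_tmul (i : ℕ) : Bup F i =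
    ((ThreePointRing.t F - 1) ^ i * ThreePointRing.t F) ⊗ₜ[F] SlTwo.y F +
      ((ThreePointRing.t F - 1) ^ i * (ThreePointRing.t F - 1)) ⊗ₜ[F] SlTwo.z F := by
  rw [Bup, smul_add, TensorProduct.smul_tmul', TensorProduct.smul_tmul', smul_eq_mul, smul_eq_mul]

theorem ThreePointLoop.coords_Bup (i : ℕ) :
    coords F (Bup F i) = (0, -2 * ThreePointRing.t F * (ThreePointRing.t F - 1) ^ i, 0) := by
  simp [coords, Bup_eq_tmul, entry_tmul, SlTwo.y, SlTwo.z, SlTwo.f, SlTwo.h, ofNat_smul_eq_nsmul]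
  constructor <;> ring

theorem ThreePointLoop.coords_psiUp (i : ℕ) :
    coords F (psiUp F (i + 1)) = (0, 0, 2 * ThreePointRing.t F * (ThreePointRing.t F - 1) *
      (ThreePointRing.t F - 1) ^ i) := by
  simp [coords, psiUp, entry_tmul, SlTwo.z, SlTwo.h, ofNat_smul_eq_nsmul]
  ring

/-- The family `A↑↑_i`, `B↑↑_i`, `ψ↑↑_{i+1}`. -/
def loopUpFamily : ℕ ⊕ ℕ ⊕ ℕ → ThreePointLoop F :=
  Sum.elim (Aup F) (Sum.elim (Bup F) fun i => psiUp F (i + 1))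

theorem linearIndependent_loopUpFamily [CharZero F] : LinearIndependent F (loopUpFamily F) := by
  have := ThreePointRing.isDomain F
  have : CharZero (ThreePointRing F) := charZero_of_injective_algebraMap
    (FaithfulSMul.algebraMap_injective F (ThreePointRing F))
  refine LinearIndependent.of_comp (ThreePointLoop.coords F) ?_
  have h2 : (2 : ThreePointRing F) ≠ 0 := two_ne_zero
  have ht := ThreePointRing.t_ne_zero F
  have h := linearIndependent_inl_union_inr' (ThreePointRing.linearIndependent_mul_pow F h2)
    (linearIndependent_inl_union_inr'
      (ThreePointRing.linearIndependent_mul_pow F (mul_ne_zero (neg_ne_zero.2 h2) ht))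
      (ThreePointRing.linearIndependent_mul_pow F
        (mul_ne_zero (mul_ne_zero h2 ht) (ThreePointRing.t_sub_one_ne_zero F))))
  convert h using 1
  funext i
  rcases i with i | i | i
  · exact ThreePointLoop.coords_Aup F i
  · exact ThreePointLoop.coords_Bup F i
  · exact ThreePointLoop.coords_psiUp F i

theorem onsagerToLoop_comp_upFamily [CharZero F] :
    (onsagerToLoop F : Onsager F →ₗ[F] ThreePointLoop F) ∘ Onsager.upFamily F =
      loopUpFamily F := by
  funext i
  rcases i with i | i | i
  · exact onsagerToLoop_upFamily_A i
  · exact onsagerToLoop_upFamily_B i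
  · exact onsagerToLoop_upFamily_psi i

/-! ### The basis of `O` and injectivity -/

/-- The basis `A↑↑_i`, `B↑↑_i`, `ψ↑↑_{i+1}` of the Onsager algebra. -/
def Onsager.upBasis [CharZero F] : Module.Basis (ℕ ⊕ ℕ ⊕ ℕ) F (Onsager F) :=
  Module.Basis.mk (v := upFamily F)
    (LinearIndependent.of_comp (onsagerToLoop F : Onsager F →ₗ[F] ThreePointLoop F)
      (onsagerToLoop_comp_upFamily F ▸ linearIndependent_loopUpFamily F))
    span_upFamily.ge

theorem Onsager.upBasis_apply [CharZero F] (i : ℕ ⊕ ℕ ⊕ ℕ) : upBasis F i = upFamily F i :=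
  Module.Basis.mk_apply _ _ i

theorem onsagerToLoop_injective [CharZero F] : Function.Injective (onsagerToLoop F) := by
  have h : LinearIndependent F
      ((onsagerToLoop F : Onsager F →ₗ[F] ThreePointLoop F) ∘ Onsager.upBasis F) := by
    rw [show ⇑(Onsager.upBasis F) = Onsager.upFamily F from funext (Onsager.upBasis_apply F),
      onsagerToLoop_comp_upFamily]
    exact linearIndependent_loopUpFamily F
  exact LinearMap.injective_of_linearIndependent (Onsager.upBasis F).span_eq h

end Independence

end

theorem mainTheorem3 (F : Type*) [Field F] [CharZero F] :
    -- `O` is identified with its image in `L(sl₂)⁺`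
    Function.Injective (onsagerToLoop F) ∧
    -- the basis of `O`
    (∃ b : Module.Basis (ℕ ⊕ ℕ ⊕ ℕ) F (Onsager F),
      (∀ i : ℕ, onsagerToLoop F (b (Sum.inl i)) = Aup F i) ∧
      (∀ i : ℕ, onsagerToLoop F (b (Sum.inr (Sum.inl i))) = Bup F i) ∧
      (∀ i : ℕ, onsagerToLoop F (b (Sum.inr (Sum.inr i))) = psiUp F (i + 1)) ∧
      b (Sum.inl 0) = Onsager.A F ∧ b (Sum.inr (Sum.inl 0)) = Onsager.B F) ∧
    onsagerToLoop F (Onsager.A F) = Aup F 0 ∧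
    onsagerToLoop F (Onsager.B F) = Bup F 0 ∧
    -- the Lie bracket
    (∀ i j : ℕ, ⁅Aup F i, Aup F j⁆ = 0) ∧
    (∀ i j : ℕ, ⁅Bup F i, Bup F j⁆ = 0) ∧
    (∀ i j : ℕ, ⁅psiUp F i, psiUp F j⁆ = 0) ∧
    (∀ i j : ℕ, ⁅psiUp F i, Aup F j⁆ = (2 : F) • psiUp F (i + j) + (2 : F) • Aup F (i + j)) ∧
    (∀ i j : ℕ, ⁅Bup F i, psiUp F j⁆ = (2 : F) • Bup F (i + j) + (2 : F) • psiUp F (i + j)) ∧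
    (∀ i j : ℕ, ⁅Aup F i, Bup F j⁆ =
      (2 : F) • Aup F (i + j) + (2 : F) • Bup F (i + j) - (4 : F) • psiUp F (i + j + 1)) := by
  refine ⟨onsagerToLoop_injective F, ⟨Onsager.upBasis F, fun i => ?_, fun i => ?_, fun i => ?_,
    ?_, ?_⟩, onsagerToLoop_A F, onsagerToLoop_B F, lie_Aup_Aup F, lie_Bup_Bup F, lie_psiUp_psiUp F,
    lie_psiUp_Aup F, lie_Bup_psiUp F, lie_Aup_Bup F⟩
  · rw [Onsager.upBasis_apply, onsagerToLoop_upFamily_A]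
  · rw [Onsager.upBasis_apply, onsagerToLoop_upFamily_B]
  · rw [Onsager.upBasis_apply, onsagerToLoop_upFamily_psi]
  · rw [Onsager.upBasis_apply]
    exact onsagerSeq_zero _ _
  · rw [Onsager.upBasis_apply]
    exact onsagerSeq_one _ _
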